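/- Throughout, a distributive lattice (DL) has a least element $0$ and a greatest element $1$, and DL morphisms preserve $\wedge,\vee,0,1$. A pre-Heyting algebra is a pair $(A,\to)$ consisting of a distributive lattice $A$ and a binary operation $\to$ on $A$ such that for all $a,b,c\in A$: (1) $a\to a=1$; (2) $a\to(b\wedge c)=(a\to b)\wedge(a\to c)$; (3) $(a\vee b)\to c=(a\to c)\wedge(b\to c)$; (4) $(a\to b)\wedge(b\to c)\le a\to c$; (5) $1\to 0=0$; (6) $(1\to a)\vee(1\to b)=1\to(a\vee b)$. For a distributive lattice $D$ let $K(D)$ be the quotient of the free distributive lattice over the set of formal arrows $\{a\rightarrowtriangle b : a,b\in D\}$ (a set in bijection with $D\times D$) by the lattice congruence generated by all instances of (1)–(6), with $a,b,c$ ranging over $D$ and $\to$ replaced by $\rightarrowtriangle$. For a DL morphism $h:D\to E$ let $K(h):K(D)\to K(E)$ be the DL morphism with $[a\rightarrowtriangle b]\mapsto[h(a)\rightarrowtriangle h(b)]$. Let $+$ denote the binary coproduct of distributive lattices. Let $n\ge 0$ be an integer and $F_{DL}(n)$ the free distributive lattice on $n$ generators. Put $D_0=F_{DL}(n)$ and $D_{k+1}=D_0+K(D_k)$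 for $k\ge 0$; let $i_0:D_0\to D_0+K(D_0)=D_1$ be the coproduct injection and $i_k=\mathrm{id}_{D_0}+K(i_{k-1}):D_k\to D_{k+1}$ for $k\ge1$. For $a,b\in D_k$ let $a\to_k b\in D_{k+1}$ be the image of $[a\rightarrowtriangle b]\in K(D_k)$ under the coproduct injection $K(D_k)\to D_{k+1}$. **Theorem.** All the maps $i_k$ are injective. Let $(D_\omega,(\varphi_k:D_k\to D_\omega)_k)$ be the direct limit of the sequence $(D_k,i_k)_k$ in the category of distributive lattices. There is exactly one binary operation $\to_\omega$ on $D_\omega$ such that $\varphi_k(a)\to_\omega\varphi_k(b)=\varphi_{k+1}(a\to_k b)$ for all $k\ge 0$ and $a,b\in D_k$, and $(D_\omega,\to_\omega)$ is the free pre-Heyting algebra on $n$ generators, with respect to the map $n\to D_0\xrightarrow{\varphi_0}D_\omega$: it is a pre-Heyting algebra, and for every pre-Heyting algebra $B$ every map $f:n\to B$ extends along $n\to D_\omega$ to a unique DL morphism $D_\omega\to B$ that preserves $\to$. -/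

import Mathlib

universe u v w

namespace FreePreHeyting

/-! ### Weak Heyting and pre-Heyting algebras

All lattices are bounded distributive lattices (`DistribLattice` with `BoundedOrder`), and their
morphisms are the lattice morphisms that preserve `⊥` and `⊤` (`BoundedLatticeHom`). -/

/-- `imp` is a weak implication, that is, `(A, imp)` is a weak Heyting algebra. -/
structure IsWeakHeyting {A : Type u} [DistribLattice A] [BoundedOrder A]
    (imp : A → A → A) : Prop where
  imp_self : ∀ a, imp a a = ⊤
  imp_inf : ∀ a b c, imp a (b ⊓ c) = imp a b ⊓ imp a c
  sup_imp : ∀ a b c, imp (a ⊔ b) c = imp a c ⊓ imp b c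
  imp_trans : ∀ a b c, imp a b ⊓ imp b c ≤ imp a c

/-- `(A, imp)` is a pre-Heyting algebra. -/
structure IsPreHeyting {A : Type u} [DistribLattice A] [BoundedOrder A]
    (imp : A → A → A) : Prop extends IsWeakHeyting imp where
  top_imp_bot : imp ⊤ ⊥ = ⊥
  top_imp_sup : ∀ a b, imp ⊤ a ⊔ imp ⊤ b = imp ⊤ (a ⊔ b)

/-- `(A, imp)` is a pre-Heyting algebra and it is free over the family `gen : X → A`, with respect
to all pre-Heyting algebras with carrier in `Type w`. -/
structure IsFreePreHeyting {X : Type u} {A : Type v} [DistribLattice A] [BoundedOrder A]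
    (imp : A → A → A) (gen : X → A) : Prop where
  isPreHeyting : IsPreHeyting imp
  existsUnique_hom : ∀ (B : Type w) [DistribLattice B] [BoundedOrder B] (impB : B → B → B),
    IsPreHeyting impB → ∀ f : X → B,
      ∃! h : BoundedLatticeHom A B,
        (∀ a b, h (imp a b) = impB (h a) (h b)) ∧ ∀ x, h (gen x) = f x

/-! ### Free bounded distributive lattices -/

/-- Bounded lattice terms in the variables `X`. -/
inductive Term (X : Type u) : Type u
  | var : X → Term X
  | bot : Term X
  | top : Term X
  | inf : Term X → Term X → Term X
  | sup : Term X → Term X → Term X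

/-- Provable equality of terms from the axioms of bounded distributive lattices. -/
inductive Term.Equal {X : Type u} : Term X → Term X → Prop
  | refl (s) : Equal s s
  | symm {s t} : Equal s t → Equal t s
  | trans {s t r} : Equal s t → Equal t r → Equal s r
  | inf_congr {s s' t t'} : Equal s s' → Equal t t' → Equal (.inf s t) (.inf s' t')
  | sup_congr {s s' t t'} : Equal s s' → Equal t t' → Equal (.sup s t) (.sup s' t')
  | inf_comm (s t) : Equal (.inf s t) (.inf t s)
  | sup_comm (s t) : Equal (.sup s t) (.sup t s)
  | inf_assoc (s t r) : Equal (.inf (.inf s t) r) (.inf s (.inf t r))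
  | sup_assoc (s t r) : Equal (.sup (.sup s t) r) (.sup s (.sup t r))
  | inf_sup_self (s t) : Equal (.inf s (.sup s t)) s
  | sup_inf_self (s t) : Equal (.sup s (.inf s t)) s
  | inf_sup_left (s t r) : Equal (.inf s (.sup t r)) (.sup (.inf s t) (.inf s r))
  | bot_sup (s) : Equal (.sup .bot s) s
  | top_inf (s) : Equal (.inf .top s) s

/-- Provable equality as a setoid. -/
def Term.setoid (X : Type u) : Setoid (Term X) where
  r := Term.Equal
  iseqv := ⟨.refl, .symm, .trans⟩

/-- A distributive lattice structure from the equational axioms. -/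
abbrev distribLatticeOfEqns {α : Type u} (j m : α → α → α)
    (sup_comm : ∀ a b, j a b = j b a) (sup_assoc : ∀ a b c, j (j a b) c = j a (j b c))
    (inf_comm : ∀ a b, m a b = m b a) (inf_assoc : ∀ a b c, m (m a b) c = m a (m b c))
    (sup_inf_self : ∀ a b, j a (m a b) = a) (inf_sup_self : ∀ a b, m a (j a b) = a)
    (inf_sup_left : ∀ a b c, m a (j b c) = j (m a b) (m a c)) : DistribLattice α where
  sup := j
  inf := m
  le a b := j a b = b
  le_refl a := by simpa only [inf_sup_self] using sup_inf_self a (j a a)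
  le_trans a b c (hab : j a b = b) (hbc : j b c = c) := show j a c = c by
    rw [← hbc, ← sup_assoc, hab]
  le_antisymm a b (hab : j a b = b) (hba : j b a = a) := by rw [← hba, sup_comm, hab]
  le_sup_left a b := show j a (j a b) = j a b by
    rw [← sup_assoc]
    congr 1
    simpa only [inf_sup_self] using sup_inf_self a (j a a)
  le_sup_right a b := show j b (j a b) = j a b by
    rw [sup_comm a b, ← sup_assoc]
    congr 1
    simpa only [inf_sup_self] using sup_inf_self b (j b b)
  sup_le a b c (hac : j a c = c) (hbc : j b c = c) := show j (j a b) c = c by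
    rw [sup_assoc, hbc, hac]
  inf_le_left a b := show j (m a b) a = a by rw [sup_comm, sup_inf_self]
  inf_le_right a b := show j (m a b) b = b by rw [sup_comm, inf_comm, sup_inf_self]
  le_inf a b c (hab : j a b = b) (hac : j a c = c) := show j a (m b c) = m b c by
    have h₁ : m a b = a := by rw [← hab, inf_sup_self]
    have h₂ : m a c = a := by rw [← hac, inf_sup_self]
    have h₃ : m a (m b c) = a := by rw [← inf_assoc, h₁, h₂]
    calc j a (m b c) = j (m b c) (m (m b c) a) := by rw [sup_comm, inf_comm (m b c) a, h₃]
      _ = m b c := sup_inf_self _ _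
  le_sup_inf a b c := show j (m (j a b) (j a c)) (j a (m b c)) = j a (m b c) by
    have h : m (j a b) (j a c) = j a (m b c) := by
      rw [inf_sup_left, inf_comm (j a b) a, inf_sup_self, inf_comm (j a b) c, inf_sup_left,
        ← sup_assoc, inf_comm c a, sup_inf_self, inf_comm c b]
    rw [h]
    simpa only [inf_sup_self] using sup_inf_self (j a (m b c)) (j (j a (m b c)) (j a (m b c)))

/-- The free bounded distributive lattice over the set `X`. -/
def FDL (X : Type u) : Type u := Quotient (Term.setoid X)

namespace FDL

variable {X : Type u}

instance : DistribLattice (FDL X) :=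
  distribLatticeOfEqns
    (Quotient.map₂ Term.sup fun _ _ h _ _ h' => Term.Equal.sup_congr h h')
    (Quotient.map₂ Term.inf fun _ _ h _ _ h' => Term.Equal.inf_congr h h')
    (by rintro ⟨a⟩ ⟨b⟩; exact Quotient.sound (.sup_comm a b))
    (by rintro ⟨a⟩ ⟨b⟩ ⟨c⟩; exact Quotient.sound (.sup_assoc a b c))
    (by rintro ⟨a⟩ ⟨b⟩; exact Quotient.sound (.inf_comm a b))
    (by rintro ⟨a⟩ ⟨b⟩ ⟨c⟩; exact Quotient.sound (.inf_assoc a b c))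
    (by rintro ⟨a⟩ ⟨b⟩; exact Quotient.sound (.sup_inf_self a b))
    (by rintro ⟨a⟩ ⟨b⟩; exact Quotient.sound (.inf_sup_self a b))
    (by rintro ⟨a⟩ ⟨b⟩ ⟨c⟩; exact Quotient.sound (.inf_sup_left a b c))

instance : BoundedOrder (FDL X) where
  bot := Quotient.mk _ .bot
  top := Quotient.mk _ .top
  bot_le := by
    rintro ⟨a⟩
    exact sup_eq_right.mp (Quotient.sound (.bot_sup a))
  le_top := by
    rintro ⟨a⟩
    exact inf_eq_right.mp (Quotient.sound (.top_inf a))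

/-- The generators. -/
def of (x : X) : FDL X := Quotient.mk _ (.var x)

/-- The value of a term under an assignment. -/
def eval {L : Type v} [DistribLattice L] [BoundedOrder L] (f : X → L) : Term X → L
  | .var x => f x
  | .bot => ⊥
  | .top => ⊤
  | .inf s t => eval f s ⊓ eval f t
  | .sup s t => eval f s ⊔ eval f t

theorem eval_eq {L : Type v} [DistribLattice L] [BoundedOrder L] (f : X → L) {s t : Term X}
    (h : s.Equal t) : eval f s = eval f t := by
  induction h with
  | refl => rfl
  | symm _ ih => exact ih.symm
  | trans _ _ ih₁ ih₂ => exact ih₁.trans ih₂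
  | inf_congr _ _ ih₁ ih₂ => simp only [eval, ih₁, ih₂]
  | sup_congr _ _ ih₁ ih₂ => simp only [eval, ih₁, ih₂]
  | inf_comm => exact _root_.inf_comm _ _
  | sup_comm => exact _root_.sup_comm _ _
  | inf_assoc => exact _root_.inf_assoc _ _ _
  | sup_assoc => exact _root_.sup_assoc _ _ _
  | inf_sup_self => exact _root_.inf_sup_self
  | sup_inf_self => exact _root_.sup_inf_self
  | inf_sup_left => exact _root_.inf_sup_left _ _ _
  | bot_sup => exact bot_sup_eq _
  | top_inf => exact top_inf_eq _

/-- The morphism on the free bounded distributive lattice that extends `f`. -/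
def lift {L : Type v} [DistribLattice L] [BoundedOrder L] (f : X → L) :
    BoundedLatticeHom (FDL X) L where
  toFun := Quotient.lift (eval f) fun _ _ h => eval_eq f h
  map_sup' := by rintro ⟨a⟩ ⟨b⟩; rfl
  map_inf' := by rintro ⟨a⟩ ⟨b⟩; rfl
  map_top' := rfl
  map_bot' := rfl

@[simp] theorem lift_of {L : Type v} [DistribLattice L] [BoundedOrder L] (f : X → L) (x : X) :
    lift f (of x) = f x := rfl

theorem hom_ext {L : Type v} [DistribLattice L] [BoundedOrder L]
    {g h : BoundedLatticeHom (FDL X) L} (e : ∀ x, g (of x) = h (of x)) : g = h := by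
  let q : Term X → FDL X := Quotient.mk _
  have key : ∀ s, g (q s) = h (q s) := by
    intro s
    induction s with
    | var x => exact e x
    | bot => exact (map_bot g).trans (map_bot h).symm
    | top => exact (map_top g).trans (map_top h).symm
    | inf s t hs ht =>
      change g (q s ⊓ q t) = h (q s ⊓ q t)
      rw [map_inf, map_inf, hs, ht]
    | sup s t hs ht =>
      change g (q s ⊔ q t) = h (q s ⊔ q t)
      rw [map_sup, map_sup, hs, ht]
  ext ⟨s⟩
  exact key s

end FDL

/-! ### Quotients by the congruence generated by a relation -/

/-- The least lattice congruence that contains the relation `r`. -/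
inductive Cong {L : Type u} [Lattice L] (r : L → L → Prop) : L → L → Prop
  | of {a b} : r a b → Cong r a b
  | refl (a) : Cong r a a
  | symm {a b} : Cong r a b → Cong r b a
  | trans {a b c} : Cong r a b → Cong r b c → Cong r a c
  | inf {a b c d} : Cong r a b → Cong r c d → Cong r (a ⊓ c) (b ⊓ d)
  | sup {a b c d} : Cong r a b → Cong r c d → Cong r (a ⊔ c) (b ⊔ d)

/-- The generated congruence as a bundled lattice congruence. -/
def congGen {L : Type u} [Lattice L] (r : L → L → Prop) : LatticeCon L where
  r := Cong r
  iseqv := ⟨.refl, .symm, .trans⟩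
  inf := .inf
  sup := .sup

/-- The quotient of a bounded distributive lattice by the congruence generated by `r`. -/
def QuotDL {L : Type u} [DistribLattice L] (r : L → L → Prop) : Type u :=
  Quotient (congGen r).toSetoid

namespace QuotDL

variable {L : Type u} [DistribLattice L] {r : L → L → Prop}

instance : DistribLattice (QuotDL r) :=
  distribLatticeOfEqns
    (Quotient.map₂ (· ⊔ ·) fun _ _ h _ _ h' => Cong.sup h h')
    (Quotient.map₂ (· ⊓ ·) fun _ _ h _ _ h' => Cong.inf h h')
    (by rintro ⟨a⟩ ⟨b⟩; exact congrArg (Quotient.mk _) (sup_comm a b))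
    (by rintro ⟨a⟩ ⟨b⟩ ⟨c⟩; exact congrArg (Quotient.mk _) (sup_assoc a b c))
    (by rintro ⟨a⟩ ⟨b⟩; exact congrArg (Quotient.mk _) (inf_comm a b))
    (by rintro ⟨a⟩ ⟨b⟩ ⟨c⟩; exact congrArg (Quotient.mk _) (inf_assoc a b c))
    (by rintro ⟨a⟩ ⟨b⟩; exact congrArg (Quotient.mk _) (sup_inf_self (a := a) (b := b)))
    (by rintro ⟨a⟩ ⟨b⟩; exact congrArg (Quotient.mk _) (inf_sup_self (a := a) (b := b)))
    (by rintro ⟨a⟩ ⟨b⟩ ⟨c⟩; exact congrArg (Quotient.mk _) (inf_sup_left a b c))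

variable [BoundedOrder L]

instance : BoundedOrder (QuotDL r) where
  bot := Quotient.mk _ ⊥
  top := Quotient.mk _ ⊤
  bot_le := by
    rintro ⟨a⟩
    exact sup_eq_right.mp (congrArg (Quotient.mk _) (bot_sup_eq a))
  le_top := by
    rintro ⟨a⟩
    exact inf_eq_right.mp (congrArg (Quotient.mk _) (top_inf_eq a))

/-- The quotient map. -/
def mk (r : L → L → Prop) : BoundedLatticeHom L (QuotDL r) where
  toFun := Quotient.mk _
  map_sup' _ _ := rfl
  map_inf' _ _ := rfl
  map_top' := rfl
  map_bot' := rfl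

theorem mk_eq {a b : L} (h : r a b) : mk r a = mk r b := Quotient.sound (Cong.of h)

theorem mk_surjective : Function.Surjective (mk r) := Quotient.mk_surjective

theorem eq_of_cong {M : Type v} [DistribLattice M] [BoundedOrder M] (f : BoundedLatticeHom L M)
    (hf : ∀ a b, r a b → f a = f b) {a b : L} (h : Cong r a b) : f a = f b := by
  induction h with
  | of h => exact hf _ _ h
  | refl => rfl
  | symm _ ih => exact ih.symm
  | trans _ _ ih₁ ih₂ => exact ih₁.trans ih₂
  | inf _ _ ih₁ ih₂ => rw [map_inf, map_inf, ih₁, ih₂]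
  | sup _ _ ih₁ ih₂ => rw [map_sup, map_sup, ih₁, ih₂]

/-- The morphism on the quotient induced by a morphism that respects `r`. -/
def lift {M : Type v} [DistribLattice M] [BoundedOrder M] (f : BoundedLatticeHom L M)
    (hf : ∀ a b, r a b → f a = f b) : BoundedLatticeHom (QuotDL r) M where
  toFun := Quotient.lift f fun _ _ h => eq_of_cong f hf h
  map_sup' := by rintro ⟨a⟩ ⟨b⟩; exact map_sup f a b
  map_inf' := by rintro ⟨a⟩ ⟨b⟩; exact map_inf f a b
  map_top' := map_top f
  map_bot' := map_bot f

@[simp] theorem lift_mk {M : Type v} [DistribLattice M] [BoundedOrder M]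
    (f : BoundedLatticeHom L M) (hf : ∀ a b, r a b → f a = f b) (a : L) :
    lift f hf (mk r a) = f a := rfl

theorem hom_ext {M : Type v} [DistribLattice M] [BoundedOrder M]
    {g h : BoundedLatticeHom (QuotDL r) M} (e : ∀ a, g (mk r a) = h (mk r a)) : g = h := by
  ext ⟨a⟩
  exact e a

end QuotDL

/-! ### Binary coproducts of bounded distributive lattices -/

/-- The relations on `FDL (D ⊕ E)` that make the two inclusions morphisms. -/
inductive CoprodRel (D : Type u) (E : Type v) [DistribLattice D] [BoundedOrder D]
    [DistribLattice E] [BoundedOrder E] : FDL (D ⊕ E) → FDL (D ⊕ E) → Prop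
  | inl_bot : CoprodRel D E (.of (.inl ⊥)) ⊥
  | inl_top : CoprodRel D E (.of (.inl ⊤)) ⊤
  | inl_inf (a b : D) : CoprodRel D E (.of (.inl (a ⊓ b))) (.of (.inl a) ⊓ .of (.inl b))
  | inl_sup (a b : D) : CoprodRel D E (.of (.inl (a ⊔ b))) (.of (.inl a) ⊔ .of (.inl b))
  | inr_bot : CoprodRel D E (.of (.inr ⊥)) ⊥
  | inr_top : CoprodRel D E (.of (.inr ⊤)) ⊤
  | inr_inf (a b : E) : CoprodRel D E (.of (.inr (a ⊓ b))) (.of (.inr a) ⊓ .of (.inr b))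
  | inr_sup (a b : E) : CoprodRel D E (.of (.inr (a ⊔ b))) (.of (.inr a) ⊔ .of (.inr b))

/-- The coproduct `D + E` in the category of bounded distributive lattices. -/
def Coprod (D : Type u) (E : Type v) [DistribLattice D] [BoundedOrder D]
    [DistribLattice E] [BoundedOrder E] : Type (max u v) :=
  QuotDL (CoprodRel D E)

namespace Coprod

variable {D : Type u} {E : Type v} [DistribLattice D] [BoundedOrder D]
  [DistribLattice E] [BoundedOrder E]

instance : DistribLattice (Coprod D E) :=
  inferInstanceAs (DistribLattice (QuotDL (CoprodRel D E)))

instance : BoundedOrder (Coprod D E) :=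
  inferInstanceAs (BoundedOrder (QuotDL (CoprodRel D E)))

/-- The first coprojection. -/
def inl : BoundedLatticeHom D (Coprod D E) where
  toFun a := QuotDL.mk (CoprodRel D E) (.of (.inl a))
  map_sup' a b := QuotDL.mk_eq (.inl_sup a b)
  map_inf' a b := QuotDL.mk_eq (.inl_inf a b)
  map_top' := QuotDL.mk_eq .inl_top
  map_bot' := QuotDL.mk_eq .inl_bot

/-- The second coprojection. -/
def inr : BoundedLatticeHom E (Coprod D E) where
  toFun b := QuotDL.mk (CoprodRel D E) (.of (.inr b))
  map_sup' a b := QuotDL.mk_eq (.inr_sup a b)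
  map_inf' a b := QuotDL.mk_eq (.inr_inf a b)
  map_top' := QuotDL.mk_eq .inr_top
  map_bot' := QuotDL.mk_eq .inr_bot

variable {M : Type w} [DistribLattice M] [BoundedOrder M]

/-- The copairing of two morphisms. -/
def desc (f : BoundedLatticeHom D M) (g : BoundedLatticeHom E M) :
    BoundedLatticeHom (Coprod D E) M :=
  QuotDL.lift (FDL.lift (Sum.elim f g)) (by rintro _ _ (_ | _ | _ | _ | _ | _ | _ | _) <;> simp)

@[simp] theorem desc_inl (f : BoundedLatticeHom D M) (g : BoundedLatticeHom E M) (a : D) :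
    desc f g (inl a) = f a := rfl

@[simp] theorem desc_inr (f : BoundedLatticeHom D M) (g : BoundedLatticeHom E M) (b : E) :
    desc f g (inr b) = g b := rfl

theorem hom_ext {g h : BoundedLatticeHom (Coprod D E) M} (el : ∀ a, g (inl a) = h (inl a))
    (er : ∀ b, g (inr b) = h (inr b)) : g = h := by
  refine QuotDL.hom_ext fun t => DFunLike.congr_fun
    (f := g.comp (QuotDL.mk (CoprodRel D E))) (g := h.comp (QuotDL.mk (CoprodRel D E))) ?_ t
  refine FDL.hom_ext ?_
  rintro (a | b)
  · exact el a
  · exact er b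

/-- The coproduct `f + g` of two morphisms. -/
def map {D' : Type*} {E' : Type*} [DistribLattice D'] [BoundedOrder D']
    [DistribLattice E'] [BoundedOrder E'] (f : BoundedLatticeHom D D')
    (g : BoundedLatticeHom E E') : BoundedLatticeHom (Coprod D E) (Coprod D' E') :=
  desc (inl.comp f) (inr.comp g)

end Coprod

/-! ### The functor `K` -/

/-- The formal arrow from `a` to `b`, a generator of the free lattice over `D × D`. -/
def formal {D : Type u} (a b : D) : FDL (D × D) := FDL.of (a, b)

/-- The axioms of pre-Heyting algebras as relation schemas for the formal arrows; an inequality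
`s ≤ t` is the relation `s ⊓ t ≈ s`. -/
inductive KRel (D : Type u) [DistribLattice D] [BoundedOrder D] :
    FDL (D × D) → FDL (D × D) → Prop
  | imp_self (a : D) : KRel D (formal a a) ⊤
  | imp_inf (a b c : D) : KRel D (formal a (b ⊓ c)) (formal a b ⊓ formal a c)
  | sup_imp (a b c : D) : KRel D (formal (a ⊔ b) c) (formal a c ⊓ formal b c)
  | imp_trans (a b c : D) :
      KRel D (formal a b ⊓ formal b c ⊓ formal a c) (formal a b ⊓ formal b c)
  | top_imp_bot : KRel D (formal ⊤ ⊥) ⊥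
  | top_imp_sup (a b : D) : KRel D (formal ⊤ a ⊔ formal ⊤ b) (formal ⊤ (a ⊔ b))

/-- The lattice `K(D)`. -/
def K (D : Type u) [DistribLattice D] [BoundedOrder D] : Type u := QuotDL (KRel D)

namespace K

variable {D : Type u} [DistribLattice D] [BoundedOrder D]

instance : DistribLattice (K D) := inferInstanceAs (DistribLattice (QuotDL (KRel D)))

instance : BoundedOrder (K D) := inferInstanceAs (BoundedOrder (QuotDL (KRel D)))

variable (D) in
/-- The quotient map of the free lattice over the formal arrows. -/
def mk : BoundedLatticeHom (FDL (D × D)) (K D) := QuotDL.mk (KRel D)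

/-- The class in `K(D)` of the formal arrow from `a` to `b`. -/
def arrow (a b : D) : K D := mk D (formal a b)

theorem mk_eq {s t : FDL (D × D)} (h : KRel D s t) : mk D s = mk D t := QuotDL.mk_eq h

theorem arrow_self (a : D) : arrow a a = ⊤ :=
  (mk_eq (KRel.imp_self a)).trans (map_top _)

theorem arrow_inf (a b c : D) : arrow a (b ⊓ c) = arrow a b ⊓ arrow a c :=
  (mk_eq (KRel.imp_inf a b c)).trans (map_inf (mk D) _ _)

theorem sup_arrow (a b c : D) : arrow (a ⊔ b) c = arrow a c ⊓ arrow b c :=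
  (mk_eq (KRel.sup_imp a b c)).trans (map_inf (mk D) _ _)

theorem arrow_trans (a b c : D) : arrow a b ⊓ arrow b c ≤ arrow a c :=
  inf_eq_left.mp (mk_eq (KRel.imp_trans a b c))

theorem top_arrow_bot : arrow (⊤ : D) ⊥ = ⊥ :=
  (mk_eq KRel.top_imp_bot).trans (map_bot (mk D))

theorem top_arrow_sup (a b : D) : arrow ⊤ a ⊔ arrow ⊤ b = arrow ⊤ (a ⊔ b) :=
  (map_sup (mk D) _ _).symm.trans (mk_eq (KRel.top_imp_sup a b))

/-- The morphism out of `K(D)` induced by a map on formal arrows that respects the axioms. -/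
def lift {M : Type w} [DistribLattice M] [BoundedOrder M] (f : D → D → M)
    (imp_self : ∀ a, f a a = ⊤) (imp_inf : ∀ a b c, f a (b ⊓ c) = f a b ⊓ f a c)
    (sup_imp : ∀ a b c, f (a ⊔ b) c = f a c ⊓ f b c)
    (imp_trans : ∀ a b c, f a b ⊓ f b c ≤ f a c) (top_imp_bot : f ⊤ ⊥ = ⊥)
    (top_imp_sup : ∀ a b, f ⊤ a ⊔ f ⊤ b = f ⊤ (a ⊔ b)) : BoundedLatticeHom (K D) M :=
  QuotDL.lift (FDL.lift fun p : D × D => f p.1 p.2) (by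
    rintro _ _ (a | ⟨a, b, c⟩ | ⟨a, b, c⟩ | ⟨a, b, c⟩ | _ | ⟨a, b⟩) <;>
      simp only [formal, map_inf, map_sup, map_top, map_bot, FDL.lift_of]
    · exact imp_self a
    · exact imp_inf a b c
    · exact sup_imp a b c
    · exact inf_eq_left.mpr (imp_trans a b c)
    · exact top_imp_bot
    · exact top_imp_sup a b)

variable {E : Type v} [DistribLattice E] [BoundedOrder E]

/-- The functor `K` on morphisms: `K(h)` sends the class of the formal arrow from `a` to `b` to
the class of the formal arrow from `h a` to `h b`. -/
def map (h : BoundedLatticeHom D E) : BoundedLatticeHom (K D) (K E) :=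
  lift (fun a b => arrow (h a) (h b)) (fun _ => arrow_self _)
    (fun a b c => by rw [map_inf, arrow_inf]) (fun a b c => by rw [map_sup, sup_arrow])
    (fun a b c => arrow_trans _ _ _) (by rw [map_top, map_bot, top_arrow_bot])
    (fun a b => by rw [map_top, map_sup, top_arrow_sup])

@[simp] theorem map_arrow (h : BoundedLatticeHom D E) (a b : D) :
    map h (arrow a b) = arrow (h a) (h b) := rfl

theorem hom_ext {M : Type w} [DistribLattice M] [BoundedOrder M]
    {g h : BoundedLatticeHom (K D) M} (e : ∀ a b, g (arrow a b) = h (arrow a b)) : g = h := by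
  refine QuotDL.hom_ext fun t => DFunLike.congr_fun
    (f := g.comp (QuotDL.mk (KRel D))) (g := h.comp (QuotDL.mk (KRel D))) ?_ t
  exact FDL.hom_ext fun p => e p.1 p.2

end K

/-! ### Direct limits of sequences of bounded distributive lattices -/

section DirLim

variable {D : ℕ → Type u} [∀ k, DistribLattice (D k)] [∀ k, BoundedOrder (D k)]

/-- The composite `D j → D (j + 1) → ⋯ → D k` of the maps of the sequence. -/
def transition (i : ∀ k, BoundedLatticeHom (D k) (D (k + 1))) (j k : ℕ) (h : j ≤ k) :
    BoundedLatticeHom (D j) (D k) :=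
  Nat.leRec (motive := fun k _ => BoundedLatticeHom (D j) (D k)) (BoundedLatticeHom.id (D j))
    (fun k _ f => (i k).comp f) h

theorem transition_self (i : ∀ k, BoundedLatticeHom (D k) (D (k + 1))) (j : ℕ) :
    transition i j j le_rfl = BoundedLatticeHom.id (D j) := Nat.leRec_self _ _

theorem transition_succ (i : ∀ k, BoundedLatticeHom (D k) (D (k + 1))) (j k : ℕ) (h : j ≤ k) :
    transition i j (k + 1) (h.trans k.le_succ) = (i k).comp (transition i j k h) :=
  Nat.leRec_succ _ _ _

instance (i : ∀ k, BoundedLatticeHom (D k) (D (k + 1))) :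
    DirectedSystem D fun j k h => transition i j k h where
  map_self j x := by rw [transition_self]; rfl
  map_map l k j hjk hkl x := by
    induction l, hkl using Nat.le_induction with
    | base => rw [transition_self]; rfl
    | succ l hkl ih =>
      rw [transition_succ i k l hkl, transition_succ i j l (hjk.trans hkl)]
      exact congrArg (i l) ih

/-- The direct limit of the sequence, with pointwise lattice operations. -/
def DirLim (i : ∀ k, BoundedLatticeHom (D k) (D (k + 1))) : Type u :=
  DirectLimit D (transition i)

namespace DirLim

variable (i : ∀ k, BoundedLatticeHom (D k) (D (k + 1)))

/-- The join on the direct limit, computed in any `D k` that contains both arguments. -/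
noncomputable def join : DirLim i → DirLim i → DirLim i :=
  DirectLimit.map₂ (transition i) (transition i) (transition i) (fun _ a b => a ⊔ b)
    fun _ _ _ _ _ => map_sup _ _ _

/-- The meet on the direct limit, computed in any `D k` that contains both arguments. -/
noncomputable def meet : DirLim i → DirLim i → DirLim i :=
  DirectLimit.map₂ (transition i) (transition i) (transition i) (fun _ a b => a ⊓ b)
    fun _ _ _ _ _ => map_inf _ _ _

/-- The canonical map `D k → DirLim i` as a function. -/
def mk (k : ℕ) (a : D k) : DirLim i := (Quotient.mk _ ⟨k, a⟩ : DirectLimit D (transition i))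

theorem mk_join (k : ℕ) (a b : D k) : mk i k (a ⊔ b) = join i (mk i k a) (mk i k b) :=
  (DirectLimit.map₂_def (transition i) (transition i) (transition i) (fun _ a b => a ⊔ b)
    (fun _ _ _ _ _ => map_sup _ _ _) k a b).symm

theorem mk_meet (k : ℕ) (a b : D k) : mk i k (a ⊓ b) = meet i (mk i k a) (mk i k b) :=
  (DirectLimit.map₂_def (transition i) (transition i) (transition i) (fun _ a b => a ⊓ b)
    (fun _ _ _ _ _ => map_inf _ _ _) k a b).symm

theorem mk_transition (j k : ℕ) (h : j ≤ k) (a : D j) :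
    mk i k (transition i j k h a) = mk i j a :=
  DirectLimit.mk_apply (f := transition i) j k a h

theorem exists_mk (x : DirLim i) : ∃ k a, x = mk i k a :=
  DirectLimit.exists_eq_mk (transition i) x

theorem exists_mk₂ (x y : DirLim i) : ∃ k a b, x = mk i k a ∧ y = mk i k b :=
  DirectLimit.exists_eq_mk₂ (transition i) x y

theorem exists_mk₃ (x y z : DirLim i) : ∃ k a b c, x = mk i k a ∧ y = mk i k b ∧ z = mk i k c :=
  DirectLimit.exists_eq_mk₃ (transition i) x y z

noncomputable instance : DistribLattice (DirLim i) :=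
  distribLatticeOfEqns (join i) (meet i)
    (fun x y => by
      obtain ⟨k, a, b, rfl, rfl⟩ := exists_mk₂ i x y
      rw [← mk_join, ← mk_join, sup_comm])
    (fun x y z => by
      obtain ⟨k, a, b, c, rfl, rfl, rfl⟩ := exists_mk₃ i x y z
      rw [← mk_join, ← mk_join, ← mk_join, ← mk_join, sup_assoc])
    (fun x y => by
      obtain ⟨k, a, b, rfl, rfl⟩ := exists_mk₂ i x y
      rw [← mk_meet, ← mk_meet, inf_comm])
    (fun x y z => by
      obtain ⟨k, a, b, c, rfl, rfl, rfl⟩ := exists_mk₃ i x y z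
      rw [← mk_meet, ← mk_meet, ← mk_meet, ← mk_meet, inf_assoc])
    (fun x y => by
      obtain ⟨k, a, b, rfl, rfl⟩ := exists_mk₂ i x y
      rw [← mk_meet, ← mk_join, sup_inf_self])
    (fun x y => by
      obtain ⟨k, a, b, rfl, rfl⟩ := exists_mk₂ i x y
      rw [← mk_join, ← mk_meet, inf_sup_self])
    (fun x y z => by
      obtain ⟨k, a, b, c, rfl, rfl, rfl⟩ := exists_mk₃ i x y z
      rw [← mk_join, ← mk_meet, ← mk_meet, ← mk_meet, ← mk_join, inf_sup_left])

theorem mk_sup (k : ℕ) (a b : D k) : mk i k (a ⊔ b) = mk i k a ⊔ mk i k b := mk_join i k a b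

theorem mk_inf (k : ℕ) (a b : D k) : mk i k (a ⊓ b) = mk i k a ⊓ mk i k b := mk_meet i k a b

theorem mk_bot (k : ℕ) : mk i k ⊥ = mk i 0 ⊥ := by
  rw [← mk_transition i 0 k k.zero_le ⊥, map_bot]

theorem mk_top (k : ℕ) : mk i k ⊤ = mk i 0 ⊤ := by
  rw [← mk_transition i 0 k k.zero_le ⊤, map_top]

noncomputable instance : BoundedOrder (DirLim i) where
  bot := mk i 0 ⊥
  top := mk i 0 ⊤
  bot_le x := by
    obtain ⟨k, a, rfl⟩ := exists_mk i x
    rw [← mk_bot i k, ← sup_eq_right, ← mk_sup, bot_sup_eq]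
  le_top x := by
    obtain ⟨k, a, rfl⟩ := exists_mk i x
    rw [← mk_top i k, ← inf_eq_left, ← mk_inf, inf_top_eq]

/-- The canonical morphism `D k → DirLim i`. -/
noncomputable def incl (k : ℕ) : BoundedLatticeHom (D k) (DirLim i) where
  toFun := mk i k
  map_sup' := mk_sup i k
  map_inf' := mk_inf i k
  map_top' := mk_top i k
  map_bot' := mk_bot i k

end DirLim

/-- The universal property of the direct limit `(L, φ)` of the sequence `(D, i)`, with respect to
all bounded distributive lattices with carrier in `Type w`. -/
structure IsDirectLimit {L : Type v} [DistribLattice L] [BoundedOrder L]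
    (i : ∀ k, BoundedLatticeHom (D k) (D (k + 1))) (φ : ∀ k, BoundedLatticeHom (D k) L) :
    Prop where
  compat : ∀ k a, φ (k + 1) (i k a) = φ k a
  existsUnique_desc : ∀ (M : Type w) [DistribLattice M] [BoundedOrder M]
    (ψ : ∀ k, BoundedLatticeHom (D k) M), (∀ k a, ψ (k + 1) (i k a) = ψ k a) →
      ∃! h : BoundedLatticeHom L M, ∀ k a, h (φ k a) = ψ k a

end DirLim

/-! ### The chain of lattices `D₀ = F_DL(n)`, `Dₖ₊₁ = D₀ + K(Dₖ)` -/

/-- The bounded distributive lattices `Dₖ`. -/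
def stage (n : ℕ) : ℕ → BddDistLat.{0}
  | 0 => .of (FDL (Fin n))
  | k + 1 => .of (Coprod (FDL (Fin n)) (K (stage n k)))

/-- The maps `iₖ : Dₖ → Dₖ₊₁`: the first coprojection for `k = 0`, and `id + K(iₖ)` at `k + 1`. -/
def stageMap (n : ℕ) : ∀ k, BoundedLatticeHom (stage n k) (stage n (k + 1))
  | 0 => (Coprod.inl : BoundedLatticeHom (FDL (Fin n)) (Coprod (FDL (Fin n)) (K (stage n 0))))
  | k + 1 => (Coprod.map (BoundedLatticeHom.id (FDL (Fin n))) (K.map (stageMap n k)) :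
      BoundedLatticeHom (Coprod (FDL (Fin n)) (K (stage n k)))
        (Coprod (FDL (Fin n)) (K (stage n (k + 1)))))

/-- The operation `→ₖ : Dₖ × Dₖ → Dₖ₊₁`. -/
def stageArrow (n k : ℕ) (a b : stage n k) : stage n (k + 1) :=
  (Coprod.inr (K.arrow a b) : Coprod (FDL (Fin n)) (K (stage n k)))

/-- The direct limit `D_ω` of the chain. -/
def Dω (n : ℕ) : Type := DirLim (stageMap n)

noncomputable instance (n : ℕ) : DistribLattice (Dω n) :=
  inferInstanceAs (DistribLattice (DirLim (stageMap n)))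

noncomputable instance (n : ℕ) : BoundedOrder (Dω n) :=
  inferInstanceAs (BoundedOrder (DirLim (stageMap n)))

/-- The canonical morphisms `Dₖ → D_ω`. -/
noncomputable def toDω (n k : ℕ) : BoundedLatticeHom (stage n k) (Dω n) :=
  DirLim.incl (stageMap n) k

/-- The generators: the composite `n → D₀ → D_ω`. -/
noncomputable def gen (n : ℕ) (x : Fin n) : Dω n :=
  toDω n 0 (FDL.of x : FDL (Fin n))

/-- `imp` is the operation `→_ω` on `D_ω`: it is given by `→ₖ` on the elements of each `Dₖ`. -/
def IsLimitArrow (n : ℕ) (imp : Dω n → Dω n → Dω n) : Prop :=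
  ∀ (k : ℕ) (a b : stage n k),
    imp (toDω n k a) (toDω n k b) = toDω n (k + 1) (stageArrow n k a b)

end FreePreHeyting

namespace FreePreHeyting

/-! ### Retractions of the maps of the chain -/

/-! Injectivity: every `iₖ` is a split monomorphism. A retraction of `i₀ : D₀ → D₀ + K(D₀)` is the
identity on `D₀` paired with an arbitrary morphism `K(D₀) → D₀`. One exists because a morphism `p :
D₀ → 2` turns material implication on `2` into a morphism `K(D₀) → 2`, which is followed by `2 →
D₀`. The functor `id + K(-)` preserves left inverses, so a retraction of `iₖ` yields one of `iₖ₊₁`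
(`exists_leftInverse_stageMap`).

Freeness: because `iₖ₊₁ = id + K(iₖ)`, the arrows commute with the chain maps
(`stageMap_stageArrow`) and pass to the limit. Finitely many elements of the limit lie in one stage,
where the axioms hold by the relations that define `K`. A valuation `f` in a pre-Heyting algebra `B`
extends to `D₀`, and a morphism `Dₖ → B` extends uniquely to the formal arrows in `K(Dₖ)`; this
recursion gives a compatible family (`stageDesc`), hence a morphism on the limit. The same recursion
is forced on any arrow-preserving extension of `f` (`hom_toDω_eq`). Injectivity plays no role in
this half. -/

/-- The unique morphism from the two-element lattice. -/
def ofBool (M : Type u) [DistribLattice M] [BoundedOrder M] : BoundedLatticeHom Bool M where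
  toFun b := cond b ⊤ ⊥
  map_sup' := by rintro (_ | _) (_ | _) <;> simp
  map_inf' := by rintro (_ | _) (_ | _) <;> simp
  map_top' := rfl
  map_bot' := rfl

/-- The morphism from `K D` to the two-element lattice given by material implication along a
morphism from `D` to the two-element lattice. -/
noncomputable def K.toBool {D : Type u} [DistribLattice D] [BoundedOrder D] (p : BoundedLatticeHom D Bool) :
    BoundedLatticeHom (K D) Bool :=
  K.lift (fun a b => !(p a) || p b)
    (fun a => by cases p a <;> rfl)
    (fun a b c => by rw [map_inf]; cases p a <;> cases p b <;> cases p c <;> rfl)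
    (fun a b c => by rw [map_sup]; cases p a <;> cases p b <;> cases p c <;> rfl)
    (fun a b c => by cases p a <;> cases p b <;> cases p c <;> decide)
    (by rw [map_top, map_bot]; rfl)
    (fun a b => by rw [map_top, map_sup]; cases p a <;> cases p b <;> rfl)

/-- Functoriality of `K`: the arrows generate `K D`, so it is enough to compare the composite with
the identity on them. -/
theorem K.map_leftInverse {D : Type u} {E : Type v} [DistribLattice D] [BoundedOrder D]
    [DistribLattice E] [BoundedOrder E] {g : BoundedLatticeHom E D} {h : BoundedLatticeHom D E}
    (e : Function.LeftInverse g h) : Function.LeftInverse (K.map g) (K.map h) :=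
  DFunLike.congr_fun (f := (K.map g).comp (K.map h)) (g := BoundedLatticeHom.id (K D))
    (K.hom_ext fun a b => congrArg₂ K.arrow (e a) (e b))

theorem Coprod.map_id_leftInverse {C : Type w} {D : Type u} {E : Type v}
    [DistribLattice C] [BoundedOrder C] [DistribLattice D] [BoundedOrder D]
    [DistribLattice E] [BoundedOrder E] {g : BoundedLatticeHom E D} {h : BoundedLatticeHom D E}
    (e : Function.LeftInverse g h) :
    Function.LeftInverse (Coprod.map (BoundedLatticeHom.id C) g)
      (Coprod.map (BoundedLatticeHom.id C) h) :=
  DFunLike.congr_fun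
    (f := (Coprod.map (BoundedLatticeHom.id C) g).comp (Coprod.map (BoundedLatticeHom.id C) h))
    (g := BoundedLatticeHom.id (Coprod C D))
    (Coprod.hom_ext (fun _ => rfl) fun b => congrArg Coprod.inr (e b))

/-- The retraction has to be a lattice morphism, not just a function, so that `K` can be applied to
it at the next stage. -/
theorem exists_leftInverse_stageMap (n : ℕ) : ∀ k,
    ∃ r : BoundedLatticeHom (stage n (k + 1)) (stage n k),
      Function.LeftInverse r (stageMap n k)
  -- Any morphism `D₀ → 2` would serve here; this one sends all generators to `false`.
  | 0 => ⟨(Coprod.desc (BoundedLatticeHom.id (FDL (Fin n)))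
      ((ofBool (FDL (Fin n))).comp (K.toBool (FDL.lift fun _ : Fin n => false))) :
        BoundedLatticeHom (Coprod (FDL (Fin n)) (K (FDL (Fin n)))) (FDL (Fin n))), fun _ => rfl⟩
  | k + 1 => by
    obtain ⟨r, hr⟩ := exists_leftInverse_stageMap n k
    exact ⟨(Coprod.map (BoundedLatticeHom.id (FDL (Fin n))) (K.map r) :
      BoundedLatticeHom (Coprod (FDL (Fin n)) (K (stage n (k + 1))))
        (Coprod (FDL (Fin n)) (K (stage n k)))), Coprod.map_id_leftInverse (K.map_leftInverse hr)⟩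

theorem stageMap_injective (n k : ℕ) : Function.Injective (stageMap n k) :=
  let ⟨_, hr⟩ := exists_leftInverse_stageMap n k
  hr.injective

/-! ### The universal property of the direct limit -/

section DirLim

variable {D : ℕ → Type u} [∀ k, DistribLattice (D k)] [∀ k, BoundedOrder (D k)]
  (i : ∀ k, BoundedLatticeHom (D k) (D (k + 1)))

theorem apply_transition {C : Sort w} (ψ : ∀ k, D k → C) (hψ : ∀ k a, ψ (k + 1) (i k a) = ψ k a)
    (j k : ℕ) (h : j ≤ k) (a : D j) : ψ k (transition i j k h a) = ψ j a := by
  induction k, h using Nat.le_induction with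
  | base => rw [transition_self]; rfl
  | succ k h ih =>
    rw [transition_succ i j k h]
    exact (hψ k _).trans ih

/-- Both arguments move along the chain together, as required for an operation like `→ₖ` whose
values lie one stage higher than its arguments. -/
theorem apply_transition₂ {C : Sort w} (ψ : ∀ k, D k → D k → C)
    (hψ : ∀ k a b, ψ (k + 1) (i k a) (i k b) = ψ k a b) (j k : ℕ) (h : j ≤ k) (a b : D j) :
    ψ k (transition i j k h a) (transition i j k h b) = ψ j a b := by
  induction k, h using Nat.le_induction with
  | base => rw [transition_self]; rfl
  | succ k h ih =>
    rw [transition_succ i j k h]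
    exact (hψ k _ _).trans ih

namespace DirLim

theorem incl_map (k : ℕ) (a : D k) : incl i (k + 1) (i k a) = incl i k a := by
  have h := mk_transition i k (k + 1) k.le_succ a
  rw [transition_succ i k k le_rfl, transition_self] at h
  exact h

theorem exists_incl (x : DirLim i) : ∃ k a, x = incl i k a := exists_mk i x

theorem exists_incl₂ (x y : DirLim i) : ∃ k a b, x = incl i k a ∧ y = incl i k b :=
  exists_mk₂ i x y

theorem exists_incl₃ (x y z : DirLim i) :
    ∃ k a b c, x = incl i k a ∧ y = incl i k b ∧ z = incl i k c :=
  exists_mk₃ i x y z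

/-- The morphism on the direct limit induced by a compatible family of morphisms. -/
def desc {M : Type w} [DistribLattice M] [BoundedOrder M]
    (ψ : ∀ k, BoundedLatticeHom (D k) M) (hψ : ∀ k a, ψ (k + 1) (i k a) = ψ k a) :
    BoundedLatticeHom (DirLim i) M where
  toFun := DirectLimit.lift (transition i) (fun k a => ψ k a) fun j k h a =>
    (apply_transition i (fun k a => ψ k a) hψ j k h a).symm
  map_sup' x y := by
    obtain ⟨k, a, b, rfl, rfl⟩ := exists_incl₂ i x y
    rw [← map_sup]
    exact map_sup (ψ k) a b
  map_inf' x y := by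
    obtain ⟨k, a, b, rfl, rfl⟩ := exists_incl₂ i x y
    rw [← map_inf]
    exact map_inf (ψ k) a b
  -- The bounds of the limit are by definition the classes of the bounds of stage 0.
  map_top' := map_top (ψ 0)
  map_bot' := map_bot (ψ 0)

theorem desc_incl {M : Type w} [DistribLattice M] [BoundedOrder M]
    (ψ : ∀ k, BoundedLatticeHom (D k) M) (hψ : ∀ k a, ψ (k + 1) (i k a) = ψ k a)
    (k : ℕ) (a : D k) : desc i ψ hψ (incl i k a) = ψ k a := rfl

theorem isDirectLimit : IsDirectLimit.{u, u, w} i (incl i) where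
  compat := incl_map i
  existsUnique_desc M _ _ ψ hψ := by
    refine ⟨desc i ψ hψ, desc_incl i ψ hψ, fun h hh => ?_⟩
    ext x
    obtain ⟨k, a, rfl⟩ := exists_incl i x
    rw [hh, desc_incl]

/-- The source of the limit arrow. The maps `ψ k` are plain functions, since an implication is not a
lattice morphism in its two arguments. -/
theorem exists_binary {C : Type w} (ψ : ∀ k, D k → D k → C)
    (hψ : ∀ k a b, ψ (k + 1) (i k a) (i k b) = ψ k a b) :
    ∃ F : DirLim i → DirLim i → C, ∀ k a b, F (incl i k a) (incl i k b) = ψ k a b :=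
  have compat := fun j k h a b => (apply_transition₂ i ψ hψ j k h a b).symm
  ⟨DirectLimit.lift₂ (transition i) (transition i) ψ compat,
    DirectLimit.lift₂_def (transition i) (transition i) ψ compat⟩

end DirLim

end DirLim

/-! ### The implication on the limit -/

theorem toDω_stageMap (n k : ℕ) (a : stage n k) :
    toDω n (k + 1) (stageMap n k a) = toDω n k a :=
  DirLim.incl_map (stageMap n) k a

/-- The coherence that makes the limit arrow well defined: on the second summand `iₖ₊₁` is `K(iₖ)`,
which acts on an arrow through its two ends. -/
theorem stageMap_stageArrow (n k : ℕ) (a b : stage n k) :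
    stageMap n (k + 1) (stageArrow n k a b) =
      stageArrow n (k + 1) (stageMap n k a) (stageMap n k b) := rfl

theorem existsUnique_isLimitArrow (n : ℕ) :
    ∃! imp : Dω n → Dω n → Dω n, IsLimitArrow n imp := by
  obtain ⟨imp, h⟩ := DirLim.exists_binary (stageMap n)
    (fun k a b => toDω n (k + 1) (stageArrow n k a b)) fun k a b => by
      rw [← stageMap_stageArrow, toDω_stageMap]
  refine ⟨imp, h, fun imp' h' => ?_⟩
  funext x y
  obtain ⟨k, a, b, rfl, rfl⟩ := DirLim.exists_incl₂ (stageMap n) x y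
  exact (h' k a b).trans (h k a b).symm

/-- Each axiom involves at most three elements. They share a stage `k`, the axiom holds for their
arrows in `K(Dₖ)`, and the morphism `K(Dₖ) → Dₖ₊₁ → D_ω` carries it over. -/
theorem IsLimitArrow.isPreHeyting {n : ℕ} {imp : Dω n → Dω n → Dω n} (h : IsLimitArrow n imp) :
    IsPreHeyting imp := by
  have e : ∀ k (a b : stage n k), imp (toDω n k a) (toDω n k b) =
      (toDω n (k + 1)).comp (Coprod.inr (D := FDL (Fin n)) (E := K (stage n k)))
        (K.arrow a b) := h
  -- In the last axiom `⊤` has to be represented at the same stage as the other two elements.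
  have htop : ∀ k, (⊤ : Dω n) = toDω n k ⊤ := fun k => (map_top _).symm
  refine ⟨⟨fun x => ?_, fun x y z => ?_, fun x y z => ?_, fun x y z => ?_⟩, ?_, fun x y => ?_⟩
  · obtain ⟨k, a, rfl⟩ : ∃ k a, x = toDω n k a := DirLim.exists_incl (stageMap n) x
    rw [e, K.arrow_self, map_top]
  · obtain ⟨k, a, b, c, rfl, rfl, rfl⟩ :
      ∃ k a b c, x = toDω n k a ∧ y = toDω n k b ∧ z = toDω n k c :=
        DirLim.exists_incl₃ (stageMap n) x y z
    rw [← map_inf, e, e, e, K.arrow_inf, map_inf]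
  · obtain ⟨k, a, b, c, rfl, rfl, rfl⟩ :
      ∃ k a b c, x = toDω n k a ∧ y = toDω n k b ∧ z = toDω n k c :=
        DirLim.exists_incl₃ (stageMap n) x y z
    rw [← map_sup, e, e, e, K.sup_arrow, map_inf]
  · obtain ⟨k, a, b, c, rfl, rfl, rfl⟩ :
      ∃ k a b c, x = toDω n k a ∧ y = toDω n k b ∧ z = toDω n k c :=
        DirLim.exists_incl₃ (stageMap n) x y z
    rw [e, e, e, ← map_inf]
    exact OrderHomClass.mono _ (K.arrow_trans a b c)
  · rw [← map_top (toDω n 0), ← map_bot (toDω n 0), e, K.top_arrow_bot, map_bot, map_bot]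
  · obtain ⟨k, a, b, rfl, rfl⟩ : ∃ k a b, x = toDω n k a ∧ y = toDω n k b :=
        DirLim.exists_incl₂ (stageMap n) x y
    rw [← map_sup, htop k, e, e, e, ← map_sup, K.top_arrow_sup]

/-! ### The universal property -/

/-- The morphism from `K D` to a pre-Heyting algebra induced by a morphism from `D`. -/
def IsPreHeyting.descK {B : Type w} [DistribLattice B] [BoundedOrder B] {imp : B → B → B}
    (hB : IsPreHeyting imp) {D : Type u} [DistribLattice D] [BoundedOrder D]
    (h : BoundedLatticeHom D B) : BoundedLatticeHom (K D) B :=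
  K.lift (fun a b => imp (h a) (h b)) (fun _ => hB.imp_self _)
    (fun a b c => by rw [map_inf, hB.imp_inf]) (fun a b c => by rw [map_sup, hB.sup_imp])
    (fun a b c => hB.imp_trans _ _ _) (by rw [map_top, map_bot, hB.top_imp_bot])
    (fun a b => by rw [map_top, map_sup, hB.top_imp_sup])

theorem IsPreHeyting.descK_arrow {B : Type w} [DistribLattice B] [BoundedOrder B]
    {imp : B → B → B} (hB : IsPreHeyting imp) {D : Type u} [DistribLattice D] [BoundedOrder D]
    (h : BoundedLatticeHom D B) (a b : D) : hB.descK h (K.arrow a b) = imp (h a) (h b) := rfl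

/-- The morphisms from the stages to a pre-Heyting algebra that extend a valuation of the
generators. -/
def stageDesc {n : ℕ} {B : Type w} [DistribLattice B] [BoundedOrder B] {imp : B → B → B}
    (hB : IsPreHeyting imp) (f : Fin n → B) : ∀ k, BoundedLatticeHom (stage n k) B
  | 0 => (FDL.lift f : BoundedLatticeHom (FDL (Fin n)) B)
  | k + 1 => (Coprod.desc (FDL.lift f) (hB.descK (stageDesc hB f k)) :
      BoundedLatticeHom (Coprod (FDL (Fin n)) (K (stage n k))) B)

section stageDesc

variable {n : ℕ} {B : Type w} [DistribLattice B] [BoundedOrder B] {imp : B → B → B}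
  (hB : IsPreHeyting imp) (f : Fin n → B)

theorem stageDesc_stageArrow (k : ℕ) (a b : stage n k) :
    stageDesc hB f (k + 1) (stageArrow n k a b) =
      imp (stageDesc hB f k a) (stageDesc hB f k b) := rfl

/-- On the summand `D₀` both sides are `FDL.lift f`. On `K(Dₖ)` it suffices to test an arrow, where
the claim reduces to the previous stage at its two ends. -/
theorem stageDesc_stageMap (k : ℕ) (a : stage n k) :
    stageDesc hB f (k + 1) (stageMap n k a) = stageDesc hB f k a := by
  induction k with
  | zero => rfl
  | succ k ih =>
    refine DFunLike.congr_fun (F := BoundedLatticeHom (Coprod (FDL (Fin n)) (K (stage n k))) B)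
      (f := (stageDesc hB f (k + 2)).comp (stageMap n (k + 1))) (g := stageDesc hB f (k + 1)) ?_ a
    refine Coprod.hom_ext (fun _ => rfl) fun b => ?_
    refine DFunLike.congr_fun (F := BoundedLatticeHom (K (stage n k)) B)
      (f := (hB.descK (stageDesc hB f (k + 1))).comp (K.map (stageMap n k)))
      (g := hB.descK (stageDesc hB f k)) (K.hom_ext fun c d => ?_) b
    exact congrArg₂ imp (ih c) (ih d)

end stageDesc

/-- Uniqueness of the extension, by induction on the stage: `Dₖ₊₁` is generated by `D₀`, where `g`
is fixed by the generators, and by arrows between elements of `Dₖ`, where `g` is fixed by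
preservation of the implication. -/
theorem hom_toDω_eq {n : ℕ} {imp : Dω n → Dω n → Dω n} (h : IsLimitArrow n imp)
    {B : Type w} [DistribLattice B] [BoundedOrder B] {impB : B → B → B} (hB : IsPreHeyting impB)
    (f : Fin n → B) (g : BoundedLatticeHom (Dω n) B)
    (hg : ∀ x y, g (imp x y) = impB (g x) (g y)) (hgen : ∀ x, g (gen n x) = f x) (k : ℕ) :
    g.comp (toDω n k) = stageDesc hB f k := by
  have h₀ : g.comp (toDω n 0) = stageDesc hB f 0 :=
    FDL.hom_ext (g := (g.comp (toDω n 0) : BoundedLatticeHom (FDL (Fin n)) B)) hgen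
  induction k with
  | zero => exact h₀
  | succ k ih =>
    -- All copies of `D₀` are identified in the limit: `i₀` is the first coprojection, and each
    -- later chain map is the identity on that summand.
    have base : ∀ (k : ℕ) (a : FDL (Fin n)),
        toDω n (k + 1) (Coprod.inl a : Coprod (FDL (Fin n)) (K (stage n k))) =
          toDω n 0 (a : FDL (Fin n)) := by
      intro k a
      induction k with
      | zero => exact toDω_stageMap n 0 a
      | succ k ihk => exact (toDω_stageMap n (k + 1) _).trans ihk
    refine Coprod.hom_ext (D := FDL (Fin n)) (E := K (stage n k)) (fun a => ?_) fun b => ?_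
    · exact (congrArg g (base k a)).trans (DFunLike.congr_fun h₀ a)
    · refine DFunLike.congr_fun (F := BoundedLatticeHom (K (stage n k)) B)
        (f := (g.comp (toDω n (k + 1))).comp (Coprod.inr (D := FDL (Fin n)) (E := K (stage n k))))
        (g := hB.descK (stageDesc hB f k)) (K.hom_ext fun c d => ?_) b
      calc g (toDω n (k + 1) (stageArrow n k c d))
          = impB (g (toDω n k c)) (g (toDω n k d)) := by rw [← h k c d, hg]
        _ = impB (stageDesc hB f k c) (stageDesc hB f k d) := by rw [← ih]; rfl

theorem IsLimitArrow.isFreePreHeyting {n : ℕ} {imp : Dω n → Dω n → Dω n}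
    (h : IsLimitArrow n imp) : IsFreePreHeyting.{0, 0, w} imp (gen n) where
  isPreHeyting := h.isPreHeyting
  existsUnique_hom B _ _ impB hB f := by
    let g : BoundedLatticeHom (Dω n) B :=
      DirLim.desc (stageMap n) (stageDesc hB f) (stageDesc_stageMap hB f)
    have hg : ∀ k a, g (toDω n k a) = stageDesc hB f k a := fun _ _ => rfl
    refine ⟨g, ⟨fun x y => ?_, fun _ => rfl⟩, fun g' hg' => ?_⟩
    -- With both elements in stage `k`, their implication lies in stage `k + 1`, where the family
    -- respects arrows by construction.
    · obtain ⟨k, a, b, rfl, rfl⟩ : ∃ k a b, x = toDω n k a ∧ y = toDω n k b :=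
        DirLim.exists_incl₂ (stageMap n) x y
      rw [h, hg, hg, hg, stageDesc_stageArrow]
    · ext x
      obtain ⟨k, a, rfl⟩ : ∃ k a, x = toDω n k a := DirLim.exists_incl (stageMap n) x
      rw [hg]
      exact DFunLike.congr_fun (hom_toDω_eq h hB f g' hg'.1 hg'.2 k) a

end FreePreHeyting

theorem theorem4p4 (n : ℕ) :
    (∀ k, Function.Injective (FreePreHeyting.stageMap n k)) ∧
    FreePreHeyting.IsDirectLimit.{0, 0, u} (FreePreHeyting.stageMap n) (FreePreHeyting.toDω n) ∧
    (∃! imp : FreePreHeyting.Dω n → FreePreHeyting.Dω n → FreePreHeyting.Dω n,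
      FreePreHeyting.IsLimitArrow n imp) ∧
    ∀ imp : FreePreHeyting.Dω n → FreePreHeyting.Dω n → FreePreHeyting.Dω n,
      FreePreHeyting.IsLimitArrow n imp →
        FreePreHeyting.IsFreePreHeyting.{0, 0, u} imp (FreePreHeyting.gen n) :=
  ⟨FreePreHeyting.stageMap_injective n, FreePreHeyting.DirLim.isDirectLimit _,
    FreePreHeyting.existsUnique_isLimitArrow n, fun _ h => h.isFreePreHeyting⟩
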